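/- Let $\mathcal B$ be a real Banach space of (generalized) functions on an index set $T$; that is, there are continuous linear evaluations $b\mapsto b(t)$, $t\in T$, on $\mathcal B$, and $b\in\mathcal B$ is determined by its values $(b(t))_{t\in T}$. (For ordinary functions $T$ is the domain; for generalized functions $T$ is the set of test functions and $b(t)$ is the pairing of $b$ with $t$.) Let $U=(U(t))_{t\in T}$ be a centered Gaussian field on a probability space $(\Omega,\mathrm P)$, that is, all finite-dimensional distributions of $U$ are Gaussian (possibly degenerate) and $\mathbb E\,U(t)=0$ for every $t\in T$. Suppose that the sample paths of $U$ lie almost surely in $\mathcal B$, and regard $U$ as a random element of $\mathcal B$, strongly measurable up to a null set (for separable $\mathcal B$: Borel measurable up to a null set). For $\eta\in\mathcal B^\ast$ put $\mathcal D^2(\eta)=\mathbb E\big[\langle U,\eta\rangle^2\big]$. The field $U$ is called characteristic over $\mathcal B^\ast$ if, for $\eta\in\mathcal B^\ast$, $\mathcal D^2(\eta)=0$ only when $\eta=0$. The support of $U$ in $\mathcal B$ is $$\mathcal S_{U,\mathcal B}=\big\{f\in\mathcal B:\ \mathrm P\big[\|U-f\|_{\mathcal B}<\varepsilon\big]>0\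 \text{for every }\varepsilon>0\big\}.$$ Then $U$ is characteristic over $\mathcal B^\ast$ if and only if $\mathcal S_{U,\mathcal B}=\mathcal B$. Equivalently, $U$ is characteristic over $\mathcal B^\ast$ if and only if, for every $f\in\mathcal B$ and every $\varepsilon>0$, $$\mathrm P\big[\|U-f\|_{\mathcal B}<\varepsilon\big]>0.$$ -/

import Mathlib

open MeasureTheory ProbabilityTheory
open scoped ENNReal

/-- A real Banach space `B` is realised as a space of (generalized) functions on an index set `T`
through the continuous linear evaluations `e t : B → ℝ`: an element of `B` is determined by its
values `e t b`, `t ∈ T`.  For ordinary functions `T` is the domain and `e t` is evaluation at the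
point `t`; for generalized functions `T` is the set of test functions and `e t` is the pairing
with `t`. -/
def IsFunctionSpaceOn {T B : Type*} [NormedAddCommGroup B] [NormedSpace ℝ B]
    (e : T → StrongDual ℝ B) : Prop :=
  ∀ b b' : B, (∀ t, e t b = e t b') → b = b'

/-- The random field `U : T → Ω → ℝ` has sample paths almost surely in `B`: for almost every `ω`
the path `t ↦ U t ω` is (the function given by) the element `path ω` of `B`.  As usual for random
elements of a Banach space, `path` is strongly measurable up to a null set; if `B` is separable
this is Borel measurability up to a null set. -/
structure HasPathsIn {Ω T B : Type*} [MeasurableSpace Ω] [NormedAddCommGroup B] [NormedSpace ℝ B]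
    (e : T → StrongDual ℝ B) (U : T → Ω → ℝ) (path : Ω → B) (P : Measure Ω) : Prop where
  aestronglyMeasurable : AEStronglyMeasurable path P
  ae_eq : ∀ᵐ ω ∂P, ∀ t, U t ω = e t (path ω)

/-- The squared distance `𝒟²(η) = E ⟨U, η⟩²`, for `η` in the dual of `B`, as the expectation in
`[0, ∞]` of a nonnegative random variable. -/
noncomputable def distSq {Ω B : Type*} [MeasurableSpace Ω] [NormedAddCommGroup B]
    [NormedSpace ℝ B] (path : Ω → B) (P : Measure Ω) (η : StrongDual ℝ B) : ℝ≥0∞ :=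
  ∫⁻ ω, ENNReal.ofReal ((η (path ω)) ^ 2) ∂P

/-- The field with the given paths is characteristic over `M ⊆ B*`: for `η ∈ M`, `𝒟²(η) = 0` only
when `η = 0`. -/
def IsCharacteristicOver {Ω B : Type*} [MeasurableSpace Ω] [NormedAddCommGroup B]
    [NormedSpace ℝ B] (path : Ω → B) (P : Measure Ω) (M : Set (StrongDual ℝ B)) : Prop :=
  ∀ η ∈ M, distSq path P η = 0 → η = 0

/-- The support in `B` of the field with the given paths: all `f ∈ B` such that
`P[‖U - f‖ < ε] > 0` for every `ε > 0`. -/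
def fieldSupport {Ω B : Type*} [MeasurableSpace Ω] [NormedAddCommGroup B]
    (path : Ω → B) (P : Measure Ω) : Set B :=
  {f | ∀ ε : ℝ, 0 < ε → 0 < P {ω | ‖path ω - f‖ < ε}}

/-! `𝒟²(η) = 0` says that `η` kills almost every path. If the support is all of `B`, the open set
`{η ≠ 0}` has positive probability for each `η ≠ 0`, so `U` is characteristic.

Conversely, `cos θ • X + sin θ • X'` has the law of `U` for independent copies `X`, `X'`. This makes
the support a closed subspace (`supportSubmodule`). It carries the law, so if it were proper,
Hahn–Banach would give a nonzero `η` that kills almost every path.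

Gaussianity is assumed only for the evaluations, so `map_cos_add_sin` lifts the invariance from
finite-dimensional laws. The separability needed there follows from being characteristic. -/

/-- A vector outside a closed subspace is detected by a continuous functional vanishing on the
subspace. -/
theorem Submodule.exists_strongDual_vanishing {B : Type*} [NormedAddCommGroup B] [NormedSpace ℝ B]
    (S : Submodule ℝ B) (hS : IsClosed (S : Set B)) {x : B} (hx : x ∉ S) :
    ∃ η : StrongDual ℝ B, (∀ y ∈ S, η y = 0) ∧ η x ≠ 0 := by
  obtain ⟨η, c, hη, hc⟩ := geometric_hahn_banach_closed_point S.convex hS hx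
  have h0 : 0 < c := by simpa using hη 0 S.zero_mem
  refine ⟨η, fun y hy ↦ ?_, (h0.trans hc).ne'⟩
  by_contra hne
  -- This multiple of `y` has value exactly `c`, against the strict bound on `S`.
  have h := hη ((c / η y) • y) (S.smul_mem _ hy)
  rw [map_smul, smul_eq_mul, div_mul_cancel₀ _ hne] at h
  exact h.false

/-- A separating family of functionals on a separable space contains a countable separating
family. -/
theorem IsFunctionSpaceOn.exists_countable {T B : Type*} [NormedAddCommGroup B] [NormedSpace ℝ B]
    [SecondCountableTopology B] {e : T → StrongDual ℝ B} (he : IsFunctionSpaceOn e) :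
    ∃ S : Set T, S.Countable ∧ IsFunctionSpaceOn (fun s : S ↦ e s) := by
  -- Lindelöf property of the union of the sets `{e t ≠ 0}`, which is the complement of `0`.
  obtain ⟨S, hS, hU⟩ := TopologicalSpace.isOpen_iUnion_countable (fun t ↦ {b : B | e t b ≠ 0})
    (fun t ↦ isOpen_ne_fun (e t).continuous continuous_const)
  refine ⟨S, hS, fun b b' h ↦ he b b' fun t ↦ ?_⟩
  by_contra hne
  have hmem : b - b' ∈ ⋃ t, {b : B | e t b ≠ 0} :=
    Set.mem_iUnion.2 ⟨t, by simpa [sub_eq_zero] using hne⟩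
  rw [← hU] at hmem
  simp only [Set.mem_iUnion] at hmem
  obtain ⟨s, hs, hsne⟩ := hmem
  exact hsne (by rw [map_sub, h ⟨s, hs⟩, sub_self])

theorem ProbabilityTheory.IsGaussian.integral_strongDual_pi_eq_zero {ι : Type*} [Fintype ι]
    {ν : Measure (ι → ℝ)} [IsGaussian ν] (h : ∀ i, ∫ x, x i ∂ν = 0)
    (L : StrongDual ℝ (ι → ℝ)) : ∫ x, L x ∂ν = 0 := by
  classical
  have hL : ∀ x, L x = ∑ i, x i * L (Pi.single i 1) := fun x ↦ by
    conv_lhs => rw [← LinearMap.sum_single_apply (φ := fun _ : ι ↦ ℝ) x, map_sum]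
    refine Finset.sum_congr rfl fun i _ ↦ ?_
    rw [← smul_eq_mul, ← map_smul, ← Pi.single_smul, smul_eq_mul, mul_one]
  have hint : ∀ i, Integrable (fun x : ι → ℝ ↦ x i) ν := fun i ↦
    (IsGaussian.memLp_dual ν (ContinuousLinearMap.proj i) 1 (by simp)).integrable le_rfl
  rw [integral_congr_ae (.of_forall hL), integral_finsetSum _ fun i _ ↦ (hint i).mul_const _]
  exact Finset.sum_eq_zero fun i _ ↦ by rw [integral_mul_const, h i, zero_mul]

section Rotation

variable {T B : Type*} [NormedAddCommGroup B] [NormedSpace ℝ B] [SecondCountableTopology B]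
  [MeasurableSpace B] [BorelSpace B]

/-- The law of `cos θ • X + sin θ • X'` under a finite-dimensional projection, for independent
copies `X`, `X'` of a centered Gaussian field. -/
theorem map_pi_map_cos_add_sin {μ : Measure B} [IsProbabilityMeasure μ] {ι : Type*} [Fintype ι]
    (L : B →L[ℝ] (ι → ℝ)) (hG : IsGaussian (μ.map L)) (h0 : ∀ i, ∫ b, L b i ∂μ = 0) (θ : ℝ) :
    ((μ.prod μ).map fun p ↦ Real.cos θ • p.1 + Real.sin θ • p.2).map L = μ.map L := by
  have hLm : Measurable L := L.continuous.measurable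
  have hrot := IsGaussian.map_rotation_eq_self_of_forall_strongDual_eq_zero
    (μ := μ.map L) (fun ℓ ↦ IsGaussian.integral_strongDual_pi_eq_zero
      (fun i ↦ by
        rw [integral_map hLm.aemeasurable (measurable_pi_apply i).aestronglyMeasurable]
        exact h0 i) ℓ) θ
  -- The combination is the first coordinate of the rotated pair.
  have hfst := congrArg (Measure.map Prod.fst) hrot
  rw [Measure.map_fst_prod, measure_univ, one_smul] at hfst
  conv_rhs => rw [← hfst]
  rw [Measure.map_prod_map _ _ hLm hLm, Measure.map_map (by fun_prop) (by fun_prop),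
    Measure.map_map (by fun_prop) (by fun_prop), Measure.map_map (by fun_prop) (by fun_prop)]
  congr 1
  ext p
  simp [ContinuousLinearMap.rotation_apply]

/-- The law of a centered Gaussian field in a separable Banach function space is invariant under
`(X, X') ↦ cos θ • X + sin θ • X'` for independent copies. -/
theorem map_cos_add_sin [CompleteSpace B] {μ : Measure B} [IsProbabilityMeasure μ]
    {e : T → StrongDual ℝ B} (he : IsFunctionSpaceOn e)
    (hG : IsGaussianProcess (fun t b ↦ e t b) μ) (h0 : ∀ t, ∫ b, e t b ∂μ = 0) (θ : ℝ) :
    (μ.prod μ).map (fun p ↦ Real.cos θ • p.1 + Real.sin θ • p.2) = μ := by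
  obtain ⟨S, hS, hsep⟩ := he.exists_countable
  have : Countable S := hS
  let E : B → S → ℝ := fun b s ↦ e s b
  have hEm : Measurable E := measurable_pi_iff.2 fun s ↦ (e s).continuous.measurable
  -- Lusin–Souslin: `B` is Polish and `E` is injective, so a law on `B` is determined by its image
  -- in `S → ℝ`.
  have hE : MeasurableEmbedding E :=
    hEm.measurableEmbedding fun b b' h ↦ hsep b b' fun s ↦ congrFun h s
  have hGS : IsGaussianProcess (fun (s : S) b ↦ e s b) μ := hG.comp_right Subtype.val
  suffices h : ((μ.prod μ).map fun p ↦ Real.cos θ • p.1 + Real.sin θ • p.2).map E = μ.map E by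
    simpa only [hE.comap_map] using congrArg (Measure.comap E) h
  have hfin : ∀ I : Finset S, IsProbabilityMeasure ((μ.map E).map I.restrict) := fun I ↦
    haveI := Measure.isProbabilityMeasure_map (μ := μ) hEm.aemeasurable
    Measure.isProbabilityMeasure_map (by fun_prop)
  refine IsProjectiveLimit.unique (P := fun I ↦ (μ.map E).map I.restrict) (fun I ↦ ?_)
    fun I ↦ rfl
  have hrest : Measurable (I.restrict (π := fun _ : S ↦ ℝ)) := by fun_prop
  dsimp only
  rw [Measure.map_map hrest hEm, Measure.map_map hrest hEm]
  let L : B →L[ℝ] (I → ℝ) := ContinuousLinearMap.pi fun i ↦ e i.1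
  exact map_pi_map_cos_add_sin L (hGS.hasGaussianLaw I).isGaussian_map (fun i ↦ h0 i.1) θ

variable {μ : Measure B} [IsProbabilityMeasure μ]

theorem cos_add_sin_mem_support {θ : ℝ}
    (h : (μ.prod μ).map (fun p ↦ Real.cos θ • p.1 + Real.sin θ • p.2) = μ) {x y : B}
    (hx : x ∈ μ.support) (hy : y ∈ μ.support) :
    Real.cos θ • x + Real.sin θ • y ∈ μ.support := by
  rw [Measure.mem_support_iff_forall] at *
  intro V hV
  have hcont : Continuous fun p : B × B ↦ Real.cos θ • p.1 + Real.sin θ • p.2 := by fun_prop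
  obtain ⟨V₁, hV₁, V₂, hV₂, hsub⟩ := mem_nhds_prod_iff.1 (hcont.continuousAt (x := (x, y)) hV)
  calc 0 < μ V₁ * μ V₂ := ENNReal.mul_pos (hx V₁ hV₁).ne' (hy V₂ hV₂).ne'
    _ = (μ.prod μ) (V₁ ×ˢ V₂) := (Measure.prod_prod _ _).symm
    _ ≤ _ := measure_mono hsub
    _ ≤ ((μ.prod μ).map fun p ↦ Real.cos θ • p.1 + Real.sin θ • p.2) V :=
      Measure.le_map_apply hcont.aemeasurable V
    _ = μ V := by rw [h]

/-- Once `0` is in the support, the angle `arccos c` gives every factor with `|c| ≤ 1`; powers of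
two supply the larger ones. -/
theorem smul_mem_support
    (h : ∀ θ : ℝ, (μ.prod μ).map (fun p ↦ Real.cos θ • p.1 + Real.sin θ • p.2) = μ) (c : ℝ)
    {x : B} (hx : x ∈ μ.support) : c • x ∈ μ.support := by
  have small : ∀ c : ℝ, |c| ≤ 1 → ∀ x ∈ μ.support, c • x ∈ μ.support := by
    intro c hc x hx
    obtain ⟨h1, h2⟩ := abs_le.1 hc
    have hz : (0 : B) ∈ μ.support := by
      -- Angle `π` gives `-x`; angle `π / 4` then cancels `x` against `-x`.
      have hneg := cos_add_sin_mem_support (h Real.pi) hx hx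
      have := cos_add_sin_mem_support (h (Real.pi / 4)) hx hneg
      simpa [Real.cos_pi_div_four, Real.sin_pi_div_four] using this
    have := cos_add_sin_mem_support (h (Real.arccos c)) hx hz
    simpa [Real.cos_arccos h1 h2] using this
  have sqrt_two : ∀ x ∈ μ.support, (√2 : ℝ) • x ∈ μ.support := by
    intro x hx
    have := cos_add_sin_mem_support (h (Real.pi / 4)) hx hx
    rw [Real.cos_pi_div_four, Real.sin_pi_div_four, ← add_smul, add_halves] at this
    exact this
  have two_pow : ∀ n : ℕ, (2 : ℝ) ^ n • x ∈ μ.support := by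
    intro n
    induction n with
    | zero => simpa using hx
    | succ n ih =>
      have := sqrt_two _ (sqrt_two _ ih)
      rwa [smul_smul, smul_smul, Real.mul_self_sqrt (by norm_num), ← pow_succ'] at this
  obtain ⟨n, hn⟩ := pow_unbounded_of_one_lt |c| (one_lt_two : (1 : ℝ) < 2)
  have hpos : (0 : ℝ) < 2 ^ n := by positivity
  have := small (c / 2 ^ n) (by rw [abs_div, abs_of_pos hpos, div_le_one hpos]; exact hn.le) _
    (two_pow n)
  rwa [smul_smul, div_mul_cancel₀ _ hpos.ne'] at this

/-- The support of a rotation invariant law is a subspace. -/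
def supportSubmodule
    (h : ∀ θ : ℝ, (μ.prod μ).map (fun p ↦ Real.cos θ • p.1 + Real.sin θ • p.2) = μ) :
    Submodule ℝ B where
  carrier := μ.support
  zero_mem' := by
    obtain ⟨x, hx⟩ := Measure.nonempty_support (μ := μ) (IsProbabilityMeasure.ne_zero μ)
    simpa using smul_mem_support h 0 hx
  smul_mem' c _ hx := smul_mem_support h c hx
  add_mem' {x y} hx hy := by
    -- The factor `√2` undoes the `√2 / 2` from angle `π / 4`.
    have := smul_mem_support h √2 (cos_add_sin_mem_support (h (Real.pi / 4)) hx hy)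
    have h2 : √2 * (√2 / 2) = (1 : ℝ) := by
      rw [← mul_div_assoc, Real.mul_self_sqrt (by norm_num), div_self two_ne_zero]
    rwa [Real.cos_pi_div_four, Real.sin_pi_div_four, smul_add, smul_smul, smul_smul, h2, one_smul,
      one_smul] at this

end Rotation

section Field

variable {Ω T B : Type*} [MeasurableSpace Ω] {P : Measure Ω} [NormedAddCommGroup B]
  [NormedSpace ℝ B] {path : Ω → B}

theorem distSq_eq_zero_iff (hp : AEStronglyMeasurable path P) (η : StrongDual ℝ B) :
    distSq path P η = 0 ↔ ∀ᵐ ω ∂P, η (path ω) = 0 := by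
  have hm : AEMeasurable (fun ω ↦ η (path ω)) P :=
    (η.continuous.comp_aestronglyMeasurable hp).aemeasurable
  rw [distSq, lintegral_eq_zero_iff' (hm.pow_const 2).ennreal_ofReal]
  refine Filter.eventually_congr (Filter.Eventually.of_forall fun ω ↦ ?_)
  rw [Pi.zero_apply, ENNReal.ofReal_eq_zero, (sq_nonneg _).ge_iff_eq', sq_eq_zero_iff]

/-- A strongly measurable random element which is not annihilated by any nonzero functional lives
in a separable space. -/
theorem IsCharacteristicOver.separableSpace (hp : AEStronglyMeasurable path P)
    (hc : IsCharacteristicOver path P Set.univ) : TopologicalSpace.SeparableSpace B := by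
  obtain ⟨g, hg, hpg⟩ := hp
  let S : Submodule ℝ B := (Submodule.span ℝ (Set.range g)).topologicalClosure
  have hsep : TopologicalSpace.IsSeparable (S : Set B) := hg.isSeparable_range.span.closure
  have htop : S = ⊤ := by
    by_contra hne
    obtain ⟨x, hx⟩ : ∃ x, x ∉ S := by
      by_contra! hall
      exact hne (eq_top_iff.2 fun x _ ↦ hall x)
    obtain ⟨η, hη, hηx⟩ := S.exists_strongDual_vanishing
      (Submodule.isClosed_topologicalClosure _) hx
    refine hηx ?_
    rw [hc η (Set.mem_univ η) ((distSq_eq_zero_iff ⟨g, hg, hpg⟩ η).2 ?_), zero_apply]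
    filter_upwards [hpg] with ω hω
    rw [hω]
    exact hη _ (Submodule.le_topologicalClosure _ (Submodule.subset_span ⟨ω, rfl⟩))
  rw [htop, Submodule.top_coe] at hsep
  exact TopologicalSpace.isSeparable_univ_iff.1 hsep

theorem fieldSupport_eq_support_map {Ω B : Type*} [MeasurableSpace Ω] {P : Measure Ω}
    [NormedAddCommGroup B] [MeasurableSpace B] [BorelSpace B] {path : Ω → B}
    (hp : AEMeasurable path P) : fieldSupport path P = (P.map path).support := by
  ext f
  rw [Metric.nhds_basis_ball.mem_measureSupport]
  refine forall₂_congr fun ε _ ↦ ?_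
  rw [Measure.map_apply_of_aemeasurable hp Metric.isOpen_ball.measurableSet]
  simp only [Set.preimage, Metric.mem_ball, dist_eq_norm]

theorem isCharacteristicOver_of_fieldSupport_eq_univ (hp : AEStronglyMeasurable path P)
    (h : fieldSupport path P = Set.univ) : IsCharacteristicOver path P Set.univ := by
  intro η _ hη
  rw [distSq_eq_zero_iff hp] at hη
  by_contra hne
  obtain ⟨f, hf⟩ : ∃ f, η f ≠ 0 := by
    by_contra! hall
    exact hne (ContinuousLinearMap.ext hall)
  obtain ⟨ε, hε, hball⟩ := Metric.isOpen_iff.1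
    (isOpen_ne_fun η.continuous continuous_const : IsOpen {b | η b ≠ 0}) f hf
  have hpos : 0 < P {ω | ‖path ω - f‖ < ε} := (h ▸ Set.mem_univ f : f ∈ fieldSupport path P) ε hε
  refine hpos.ne' (measure_mono_null (fun ω hω ↦ ?_) (ae_iff.1 hη))
  exact hball (by rwa [Metric.mem_ball, dist_eq_norm])

variable [IsProbabilityMeasure P] [CompleteSpace B]

theorem fieldSupport_eq_univ_of_isCharacteristicOver {e : T → StrongDual ℝ B}
    (he : IsFunctionSpaceOn e) {U : T → Ω → ℝ} (hU : IsGaussianProcess U P)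
    (hU0 : ∀ t, ∫ ω, U t ω ∂P = 0) (hpath : HasPathsIn e U path P)
    (hc : IsCharacteristicOver path P Set.univ) : fieldSupport path P = Set.univ := by
  have hp := hpath.aestronglyMeasurable
  have := hc.separableSpace hp
  have : SecondCountableTopology B := UniformSpace.secondCountable_of_separable B
  borelize B
  have hpm : AEMeasurable path P := hp.aemeasurable
  have : IsProbabilityMeasure (P.map path) := Measure.isProbabilityMeasure_map hpm
  have hUe : ∀ t, U t =ᵐ[P] fun ω ↦ e t (path ω) := fun t ↦ by
    filter_upwards [hpath.ae_eq] with ω hω using hω t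
  have hG : IsGaussianProcess (fun t b ↦ e t b) (P.map path) := by
    refine ⟨fun I ↦ ⟨?_⟩⟩
    have hm : Measurable fun b : B ↦ I.restrict fun t ↦ e t b :=
      measurable_pi_iff.2 fun i ↦ (e i).continuous.measurable
    rw [AEMeasurable.map_map_of_aemeasurable hm.aemeasurable hpm]
    exact ((hU.congr hUe).hasGaussianLaw I).isGaussian_map
  have h0 : ∀ t, ∫ b, e t b ∂(P.map path) = 0 := fun t ↦ by
    rw [integral_map hpm (e t).continuous.aestronglyMeasurable, ← integral_congr_ae (hUe t), hU0 t]
  have hinv := map_cos_add_sin he hG h0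
  rw [fieldSupport_eq_support_map hpm]
  by_contra hne
  obtain ⟨x, hx⟩ := (Set.ne_univ_iff_exists_notMem _).1 hne
  obtain ⟨η, hη, hηx⟩ := (supportSubmodule hinv).exists_strongDual_vanishing
    Measure.isClosed_support hx
  refine hηx ?_
  rw [hc η (Set.mem_univ η) ((distSq_eq_zero_iff hp η).2 ?_), zero_apply]
  filter_upwards [ae_of_ae_map hpm (Measure.support_mem_ae (μ := P.map path))] with ω hω
    using hη _ hω

end Field

theorem mainTheorem2 {Ω T B : Type*} [MeasurableSpace Ω] (P : Measure Ω) [IsProbabilityMeasure P]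
    [NormedAddCommGroup B] [NormedSpace ℝ B] [CompleteSpace B]
    (e : T → StrongDual ℝ B) (he : IsFunctionSpaceOn e)
    (U : T → Ω → ℝ) (hU : IsGaussianProcess U P) (hU0 : ∀ t, ∫ ω, U t ω ∂P = 0)
    (path : Ω → B) (hpath : HasPathsIn e U path P) :
    (IsCharacteristicOver path P Set.univ ↔ fieldSupport path P = Set.univ) ∧
      (IsCharacteristicOver path P Set.univ ↔
        ∀ f : B, ∀ ε : ℝ, 0 < ε → 0 < P {ω | ‖path ω - f‖ < ε}) := by
  have key : IsCharacteristicOver path P Set.univ ↔ fieldSupport path P = Set.univ :=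
    ⟨fieldSupport_eq_univ_of_isCharacteristicOver he hU hU0 hpath,
      isCharacteristicOver_of_fieldSupport_eq_univ hpath.aestronglyMeasurable⟩
  exact ⟨key, key.trans Set.eq_univ_iff_forall⟩
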